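/- Let $m_1,m_2\ge 1$, let $X_i\subset\mathbb R^{m_i}$ ($i=1,2$) be bounded, open and connected, and let $Y=(a,b)\subset\mathbb R$ be a bounded open interval. Let $\mu_i$ be probability measures on $X_i$ that are absolutely continuous with respect to Lebesgue measure and charge every nonempty open subset of $X_i$, and let $c_i\in C^2(\overline X_i\times\overline Y)$ satisfy $D^2_{x_iy}c_i\neq 0$ on $X_i\times\overline Y$. Write $\mathcal T_{c}(\mu,\nu)=\inf_{\gamma\in\Pi(\mu,\nu)}\int c\,d\gamma$ for the optimal transport cost, and consider the hedonic problem $$\min_{\nu\in P(\overline Y)}\mathcal T_{c_1}(\mu_1,\nu)+\mathcal T_{c_2}(\mu_2,\nu).\tag{H}$$ For $y\in\overline Y$, $k\in\mathbb R$ let $X^i_{\ge}(y,k)=\{x\in X_i: D_yc_i(x,y)\ge k\}$ and $X^i_{>}(y,k)=\{x\in X_i: D_yc_i(x,y)> k\}$, and for $M\in[0,1]$ let $k_i(y,M)$ be the unique $k\in D_yc_i(\overline X_i,y)$ with $\mu_i(X^i_{\ge}(y,k))=M$. For $y\in Y$ let $M(y)\in[0,1]$ be the unique zero of the continuous, strictly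 decreasing function $M\mapsto k_1(y,M)+k_2(y,M)$ on $[0,1]$; where this function has no zero, put $M(y)=0$ if it is negative and $M(y)=1$ if it is positive. The problem (H) is called hedonically nested if $X^i_{\ge}(y,k_i(y,M(y)))\subseteq X^i_{>}(\bar y,k_i(\bar y,M(\bar y)))$ for $i=1,2$ and all $y<\bar y$ in $Y$. For $\nu\in P(\overline Y)$, the model $(c_i,\mu_i,\nu)$ is called nested if, with $k(y)=k_i(y,\nu((-\infty,y]))$, one has $X^i_{\ge}(y_0,k(y_0))\subseteq X^i_{>}(y_1,k(y_1))$ for all $y_0<y_1$ in $\overline Y$ with $\nu([y_0,y_1])>0$. Then: 1. The problem (H) is hedonically nested if and only if there is a probability measure $\nu$ on $\overline Y$ with $\nu((-\infty,y])=M(y)$ for all $y\in Y$ such that $M$ is strictly increasing on $\{y\in Y:0<M(y)<1\}$ and both $(c_1,\mu_1,\nu)$ and $(c_2,\mu_2,\nu)$ are nested. 2. Whenever $\nu\in P(\overline Y)$ satisfies $\nu((-\infty,y])=M(y)$ for all $y\in Y$ and both $(c_i,\mu_i,\nu)$ are nested (in particular in the situation of 1), $\nu$ is optimal in (H). -/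

import Mathlib

open MeasureTheory Set ProbabilityTheory

noncomputable section

namespace Hedonic

/-- The partial derivative `D_y c(x, y)` of a cost on `X × [a, b]`, one-sided at `a` and `b`. -/
def costDy {E : Type*} (c : E → ℝ → ℝ) (a b : ℝ) (x : E) (y : ℝ) : ℝ :=
  derivWithin (c x) (Icc a b) y

/-- The super-level set `X_≥(y, k) = {x ∈ X : D_y c(x, y) ≥ k}`. -/
def superlevel {E : Type*} (c : E → ℝ → ℝ) (X : Set E) (a b y k : ℝ) : Set E :=
  {x | x ∈ X ∧ k ≤ costDy c a b x y}

/-- The strict super-level set `X_>(y, k) = {x ∈ X : D_y c(x, y) > k}`. -/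
def strictSuperlevel {E : Type*} (c : E → ℝ → ℝ) (X : Set E) (a b y k : ℝ) : Set E :=
  {x | x ∈ X ∧ k < costDy c a b x y}

/-- The level `k(y, M)`: the `k` in the range of `D_y c(·, y)` on the closure of `X` for which
`μ (X_≥(y, k)) = M`. Restricting `k` to that range matters only for `M = 0` and `M = 1`, where it
selects the maximum and the minimum of `D_y c(·, y)`, respectively. -/
def splitLevel {E : Type*} [TopologicalSpace E] [MeasurableSpace E] (c : E → ℝ → ℝ) (X : Set E)
    (a b : ℝ) (μ : Measure E) (y M : ℝ) : ℝ :=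
  Function.invFunOn (fun k : ℝ => μ.real (superlevel c X a b y k))
    ((fun x => costDy c a b x y) '' closure X) M

/-- Assumptions on one side of the market: `X` is a bounded domain, `c` is a `C²` cost on
`closure X × [a, b]` with nonvanishing mixed derivative `D²_{xy} c`, and `μ` is an absolutely
continuous probability measure on `X` that charges every nonempty open subset of `X`. -/
structure IsSide {m : ℕ} (X : Set (EuclideanSpace ℝ (Fin m))) (a b : ℝ)
    (c : EuclideanSpace ℝ (Fin m) → ℝ → ℝ) (μ : Measure (EuclideanSpace ℝ (Fin m))) : Prop where
  isOpen : IsOpen X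
  isBounded : Bornology.IsBounded X
  isConnected : IsConnected X
  contDiffOn : ContDiffOn ℝ 2 (Function.uncurry c) (closure X ×ˢ Icc a b)
  nondegenerate : ∀ x ∈ X, ∀ y ∈ Icc a b, fderiv ℝ (fun x' => costDy c a b x' y) x ≠ 0
  isProbabilityMeasure : IsProbabilityMeasure μ
  concentrated : μ Xᶜ = 0
  absolutelyContinuous : μ ≪ volume
  charges_open : ∀ U : Set (EuclideanSpace ℝ (Fin m)), IsOpen U → U ⊆ X → U.Nonempty → 0 < μ U

/-- The couplings `Π(μ, ν)`. -/
def couplings {E F : Type*} [MeasurableSpace E] [MeasurableSpace F] (μ : Measure E)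
    (ν : Measure F) : Set (Measure (E × F)) :=
  {γ | γ.map Prod.fst = μ ∧ γ.map Prod.snd = ν}

/-- The optimal transport cost `𝒯_c(μ, ν)`. -/
def transportCost {E F : Type*} [MeasurableSpace E] [MeasurableSpace F] (c : E → F → ℝ)
    (μ : Measure E) (ν : Measure F) : ℝ :=
  sInf ((fun γ : Measure (E × F) => ∫ p, c p.1 p.2 ∂γ) '' couplings μ ν)

/-- The probability measures on `[a, b]`, seen as measures on `ℝ`. -/
def probOn (a b : ℝ) : Set (Measure ℝ) :=
  {ν | IsProbabilityMeasure ν ∧ ν (Icc a b)ᶜ = 0}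

/-- `(c, μ, ν)` is nested, where `k(y)` is given by `μ (X_≥(y, k(y))) = ν ((-∞, y])`. -/
def IsNested {E : Type*} [TopologicalSpace E] [MeasurableSpace E] (c : E → ℝ → ℝ) (X : Set E)
    (a b : ℝ) (μ : Measure E) (ν : Measure ℝ) : Prop :=
  ∀ y₀ ∈ Icc a b, ∀ y₁ ∈ Icc a b, y₀ < y₁ → 0 < ν (Icc y₀ y₁) →
    superlevel c X a b y₀ (splitLevel c X a b μ y₀ (ν.real (Iic y₀))) ⊆
      strictSuperlevel c X a b y₁ (splitLevel c X a b μ y₁ (ν.real (Iic y₁)))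

open Classical in
/-- The zero in `[0, 1]` of `M ↦ k₁(y, M) + k₂(y, M)`. If there is none, this (continuous) function
of `M` has a constant sign, and the value is `1` if it is positive and `0` if it is negative. -/
def hedonicZero (k₁ k₂ : ℝ → ℝ → ℝ) (y : ℝ) : ℝ :=
  if ∃ M ∈ Icc (0 : ℝ) 1, k₁ y M + k₂ y M = 0 then
    Function.invFunOn (fun M => k₁ y M + k₂ y M) (Icc 0 1) 0
  else if 0 < k₁ y 1 + k₂ y 1 then 1 else 0

/-- The inclusion in the definition of hedonic nestedness, for one side of the market and a
function `M` on the open interval `(a, b)`. -/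
def HedonicInclusion {E : Type*} [TopologicalSpace E] [MeasurableSpace E] (c : E → ℝ → ℝ)
    (X : Set E) (a b : ℝ) (μ : Measure E) (M : ℝ → ℝ) : Prop :=
  ∀ y ∈ Ioo a b, ∀ z ∈ Ioo a b, y < z →
    superlevel c X a b y (splitLevel c X a b μ y (M y)) ⊆
      strictSuperlevel c X a b z (splitLevel c X a b μ z (M z))

end Hedonic

end

/-! Write `A_i(y)` for the superlevel set at level `k_i(y, M(y))`, which has mass `M(y)`. The level
`k_i` is jointly continuous and strictly decreasing in `M`: level sets of `D_y c_i` are null because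
the mixed derivative does not vanish, and strips between two attained levels have positive mass
because `X_i` is connected. Hence `M` is continuous on `[a, b]`.

Equivalence: the hedonic inclusion makes `A_i` increasing, so `M` on `[a, b)` is the distribution
function of the image of `μ₁` under `x ↦ inf {y : x ∈ A_1(y)}`; any missing mass is an atom at `b`.
Connectedness forces `M` to increase strictly at levels in `(0, 1)`. Conversely, nestedness is
silent only across `ν`-null intervals. There `M` is constant, so strict increase leaves the values 0
and 1, where the inclusion is trivial.

Optimality: let `φ_i` be a primitive of `k_i(y, M(y))`. Nestedness makes `c_i(x, ·) - φ_i` decrease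
before, and increase after, the `y` assigned to `x`, so `φ_i` is a dual potential for `(μ_i, ν)`.
The sum `φ₁ + φ₂` has derivative `k₁ + k₂`, which is `≤ 0` where `M < 1` and `≥ 0` where `M > 0`; it
is therefore minimal `ν`-almost everywhere. Adding the two duality inequalities gives the claim. -/

open Filter Topology

namespace Hedonic

/-! ### The derivative `D_y c`, its superlevel sets and the level `k(y, M)` -/

section Side

variable {m : ℕ} {X : Set (EuclideanSpace ℝ (Fin m))} {a b : ℝ}
  {c : EuclideanSpace ℝ (Fin m) → ℝ → ℝ} {μ : Measure (EuclideanSpace ℝ (Fin m))}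

/-- Near every point, the `y`-derivative of the cost is given by a function that is continuous at
this point. -/
theorem IsSide.exists_partial (h : IsSide X a b c μ)
    {p : EuclideanSpace ℝ (Fin m) × ℝ} (hp : p ∈ closure X ×ˢ Icc a b) :
    ∃ g : EuclideanSpace ℝ (Fin m) × ℝ → ℝ,
      ContinuousWithinAt g (closure X ×ˢ Icc a b) p ∧
      ∀ᶠ q in 𝓝[closure X ×ˢ Icc a b] p, HasDerivWithinAt (c q.1) (g q) (Icc a b) q.2 := by
  have hc := h.contDiffOn p hp
  rw [show (2 : WithTop ℕ∞) = 1 + 1 by norm_num,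
    contDiffWithinAt_succ_iff_hasFDerivWithinAt' (by decide), insert_eq_of_mem hp] at hc
  obtain ⟨u, hu, hus, -, f', hf', hf'c⟩ := hc
  -- The boundary of `closure X` may be irregular, so `f'` need not be unique there. Its value on
  -- `(0, 1)` is, since vertical segments stay in the set.
  refine ⟨fun q => f' q (0, 1), hf'c.continuousWithinAt.clm_apply continuousWithinAt_const, ?_⟩
  filter_upwards [hu] with q hq
  have hline : HasDerivWithinAt (fun y : ℝ => (q.1, y)) (0, 1) (Icc a b) q.2 :=
    (hasDerivWithinAt_const _ _ _).prodMk (hasDerivWithinAt_id _ _)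
  exact (hf' q hq).comp_hasDerivWithinAt (t := closure X ×ˢ Icc a b) q.2 hline
    (fun y hy => ⟨(hus hq).1, hy⟩)

theorem IsSide.hasDerivWithinAt (h : IsSide X a b c μ) (hab : a < b)
    {x : EuclideanSpace ℝ (Fin m)} (hx : x ∈ closure X) {y : ℝ} (hy : y ∈ Icc a b) :
    HasDerivWithinAt (c x) (costDy c a b x y) (Icc a b) y := by
  obtain ⟨g, -, hg⟩ := h.exists_partial (p := (x, y)) ⟨hx, hy⟩
  have := hg.self_of_nhdsWithin ⟨hx, hy⟩
  have he : costDy c a b x y = g (x, y) := this.derivWithin (uniqueDiffOn_Icc hab y hy)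
  rw [he]
  exact this

theorem IsSide.continuousOn_costDy (h : IsSide X a b c μ) (hab : a < b) :
    ContinuousOn (Function.uncurry (costDy c a b)) (closure X ×ˢ Icc a b) := by
  intro p hp
  obtain ⟨g, hgc, hg⟩ := h.exists_partial hp
  refine hgc.congr_of_eventuallyEq_of_mem ?_ hp
  filter_upwards [hg, self_mem_nhdsWithin] with q hq hqs
  exact hq.derivWithin (uniqueDiffOn_Icc hab _ hqs.2)

theorem IsSide.continuousOn_costDy_left (h : IsSide X a b c μ) (hab : a < b) {y : ℝ}
    (hy : y ∈ Icc a b) : ContinuousOn (fun x => costDy c a b x y) (closure X) :=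
  (h.continuousOn_costDy hab).comp (f := fun x => (x, y)) (by fun_prop) fun _ hx => ⟨hx, hy⟩

theorem IsSide.continuousOn_costDy_right (h : IsSide X a b c μ) (hab : a < b)
    {x : EuclideanSpace ℝ (Fin m)} (hx : x ∈ closure X) :
    ContinuousOn (costDy c a b x) (Icc a b) :=
  (h.continuousOn_costDy hab).comp (f := fun y => (x, y)) (by fun_prop) fun _ hy => ⟨hx, hy⟩

theorem IsSide.isCompact_closure (h : IsSide X a b c μ) : IsCompact (closure X) :=
  h.isBounded.isCompact_closure

theorem IsSide.eventually_abs_costDy_sub_lt (h : IsSide X a b c μ) (hab : a < b) {y₀ : ℝ}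
    (hy₀ : y₀ ∈ Icc a b) {ε : ℝ} (hε : 0 < ε) :
    ∀ᶠ y in 𝓝[Icc a b] y₀, ∀ x ∈ closure X, |costDy c a b x y - costDy c a b x y₀| < ε := by
  have hu := (h.isCompact_closure.prod isCompact_Icc).uniformContinuousOn_of_continuous
    (h.continuousOn_costDy hab)
  obtain ⟨δ, hδ, hd⟩ := Metric.uniformContinuousOn_iff.1 hu ε hε
  filter_upwards [self_mem_nhdsWithin, nhdsWithin_le_nhds (Metric.ball_mem_nhds y₀ hδ)]
    with y hy hyδ x hx
  have := hd (x, y) ⟨hx, hy⟩ (x, y₀) ⟨hx, hy₀⟩ (by simpa [Prod.dist_eq] using hyδ)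
  rwa [Real.dist_eq] at this

theorem IsSide.isOpen_strictSuperlevel (h : IsSide X a b c μ) (hab : a < b) {y : ℝ}
    (hy : y ∈ Icc a b) (k : ℝ) : IsOpen (strictSuperlevel c X a b y k) :=
  ((h.continuousOn_costDy_left hab hy).mono subset_closure).isOpen_inter_preimage h.isOpen
    isOpen_Ioi

theorem IsSide.isOpen_diff_superlevel (h : IsSide X a b c μ) (hab : a < b) {y : ℝ}
    (hy : y ∈ Icc a b) (k : ℝ) : IsOpen (X \ superlevel c X a b y k) := by
  have : X \ superlevel c X a b y k = X ∩ (fun x => costDy c a b x y) ⁻¹' Iio k := by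
    ext x; simp +contextual [superlevel]
  rw [this]
  exact ((h.continuousOn_costDy_left hab hy).mono subset_closure).isOpen_inter_preimage h.isOpen
    isOpen_Iio

theorem superlevel_subset (y k : ℝ) : superlevel c X a b y k ⊆ X := fun _ hx => hx.1

theorem strictSuperlevel_subset_superlevel (y k : ℝ) :
    strictSuperlevel c X a b y k ⊆ superlevel c X a b y k := fun _ hx => ⟨hx.1, hx.2.le⟩

theorem IsSide.measurableSet_superlevel (h : IsSide X a b c μ) (hab : a < b) {y : ℝ}
    (hy : y ∈ Icc a b) (k : ℝ) : MeasurableSet (superlevel c X a b y k) := by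
  rw [← sdiff_sdiff_cancel_left (superlevel_subset (c := c) (X := X) (a := a) (b := b) y k)]
  exact h.isOpen.measurableSet.diff (h.isOpen_diff_superlevel hab hy k).measurableSet

/-- A level set along which the derivative exists and does not vanish is a null set. -/
theorem measure_setOf_eq_eq_zero {E : Type*} [NormedAddCommGroup E] [InnerProductSpace ℝ E]
    [FiniteDimensional ℝ E] [MeasurableSpace E] [BorelSpace E] (ρ : Measure E)
    [ρ.IsAddHaarMeasure] (f : E → ℝ) (s : Set E) (k : ℝ) (hs : ∀ x ∈ s, f x = k)
    (hf : ∀ x ∈ s, fderiv ℝ f x ≠ 0) : ρ s = 0 := by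
  have hw : ∀ x, ∃ w : E, x ∈ s → fderiv ℝ f x w = 1 := by
    intro x
    by_cases hx : x ∈ s
    · obtain ⟨w, hw⟩ : ∃ w, fderiv ℝ f x w ≠ 0 := by
        by_contra! hcon
        exact hf x hx (ContinuousLinearMap.ext hcon)
      exact ⟨(fderiv ℝ f x w)⁻¹ • w, fun _ => by simp [hw]⟩
    · exact ⟨0, fun hx' => (hx hx').elim⟩
  choose w hw using hw
  -- On `s`, the identity agrees with `z ↦ z - (f z - k) • w x`, whose derivative at `x` kills `w x`
  -- because `fderiv ℝ f x (w x) = 1`. So the identity has a singular derivative within `s`, and its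
  -- image `s` is null by the easy case of Sard's theorem.
  have key := addHaar_image_eq_zero_of_det_fderivWithin_eq_zero ρ (s := s) (f := id)
    (f' := fun x => ContinuousLinearMap.id ℝ E - (fderiv ℝ f x).smulRight (w x)) ?_ ?_
  · simpa using key
  · intro x hx
    have hd : DifferentiableAt ℝ f x := by
      by_contra hcon
      exact hf x hx (fderiv_zero_of_not_differentiableAt hcon)
    have h1 : HasFDerivWithinAt (fun z => z - (f z - k) • w x)
        (ContinuousLinearMap.id ℝ E - (fderiv ℝ f x).smulRight (w x)) s x :=
      (hasFDerivWithinAt_id x s).sub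
        ((hd.hasFDerivAt.hasFDerivWithinAt.sub_const k).smul_const (w x))
    exact h1.congr (fun z hz => by simp [hs z hz]) (by simp [hs x hx])
  · intro x hx
    refine LinearMap.det_eq_zero_iff_ker_ne_bot.2 fun hker => ?_
    have hmem : w x ∈ LinearMap.ker ((ContinuousLinearMap.id ℝ E -
        (fderiv ℝ f x).smulRight (w x) : E →L[ℝ] E) : E →ₗ[ℝ] E) := by
      simp [LinearMap.mem_ker, hw x hx]
    rw [hker, Submodule.mem_bot] at hmem
    simpa [hmem] using hw x hx

theorem IsSide.measure_level_eq_zero (h : IsSide X a b c μ) {y : ℝ} (hy : y ∈ Icc a b) (k : ℝ) :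
    μ {x | x ∈ X ∧ costDy c a b x y = k} = 0 :=
  h.absolutelyContinuous <| measure_setOf_eq_eq_zero volume (fun x => costDy c a b x y) _ k
    (fun _ hx => hx.2) fun x hx => h.nondegenerate x hx.1 y hy

theorem IsSide.exists_costDy_gt (h : IsSide X a b c μ) {x : EuclideanSpace ℝ (Fin m)}
    (hx : x ∈ X) {y : ℝ} (hy : y ∈ Icc a b) {U : Set (EuclideanSpace ℝ (Fin m))} (hU : U ∈ 𝓝 x) :
    ∃ x' ∈ U ∩ X, costDy c a b x y < costDy c a b x' y := by
  by_contra! hcon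
  refine h.nondegenerate x hx y hy (IsLocalMax.fderiv_eq_zero ?_)
  filter_upwards [hU, h.isOpen.mem_nhds hx] with x' h1 h2 using hcon x' ⟨h1, h2⟩

theorem IsSide.exists_costDy_lt (h : IsSide X a b c μ) {x : EuclideanSpace ℝ (Fin m)}
    (hx : x ∈ X) {y : ℝ} (hy : y ∈ Icc a b) {U : Set (EuclideanSpace ℝ (Fin m))} (hU : U ∈ 𝓝 x) :
    ∃ x' ∈ U ∩ X, costDy c a b x' y < costDy c a b x y := by
  by_contra! hcon
  refine h.nondegenerate x hx y hy (IsLocalMin.fderiv_eq_zero ?_)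
  filter_upwards [hU, h.isOpen.mem_nhds hx] with x' h1 h2 using hcon x' ⟨h1, h2⟩

theorem IsSide.measure_eq_one (h : IsSide X a b c μ) : μ X = 1 := by
  have := h.isProbabilityMeasure
  exact (prob_compl_eq_zero_iff h.isOpen.measurableSet).1 h.concentrated

/-- Superlevel sets at different levels of the range have different masses. -/
theorem IsSide.real_superlevel_lt (h : IsSide X a b c μ) (hab : a < b) {y : ℝ}
    (hy : y ∈ Icc a b) {k k' : ℝ} (hk : k < k') {z z' : EuclideanSpace ℝ (Fin m)}
    (hz : z ∈ closure X) (hz' : z' ∈ closure X) (hzk : costDy c a b z y ≤ k)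
    (hzk' : k' ≤ costDy c a b z' y) :
    μ.real (superlevel c X a b y k') < μ.real (superlevel c X a b y k) := by
  have := h.isProbabilityMeasure
  have hf := h.continuousOn_costDy_left hab hy
  -- The midpoint level is attained on the closure, so the open strip between `k` and `k'` meets `X`
  -- and is charged by `μ`.
  obtain ⟨z₀, hz₀, hz₀k⟩ := h.isConnected.isPreconnected.closure.intermediate_value hz hz' hf
    (show (k + k') / 2 ∈ _ from ⟨by linarith, by linarith⟩)
  have hev : ∀ᶠ x in 𝓝[closure X] z₀, costDy c a b x y ∈ Ioo k k' :=
    hf z₀ hz₀ (isOpen_Ioo.mem_nhds (by simp only [hz₀k]; constructor <;> linarith))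
  have hne : (X ∩ (fun x => costDy c a b x y) ⁻¹' Ioo k k').Nonempty := by
    have hev' := hev.filter_mono (nhdsWithin_mono z₀ subset_closure)
    have : (𝓝[X] z₀).NeBot := mem_closure_iff_nhdsWithin_neBot.1 hz₀
    obtain ⟨x, hx, hxX⟩ := (hev'.and self_mem_nhdsWithin).exists
    exact ⟨x, hxX, hx⟩
  have hopen : IsOpen (X ∩ (fun x => costDy c a b x y) ⁻¹' Ioo k k') :=
    (hf.mono subset_closure).isOpen_inter_preimage h.isOpen isOpen_Ioo
  have hpos := h.charges_open _ hopen inter_subset_left hne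
  have hdisj : Disjoint (superlevel c X a b y k') (X ∩ (fun x => costDy c a b x y) ⁻¹' Ioo k k') :=
    disjoint_left.2 fun x hx hx' => (hx.2.trans_lt hx'.2.2).false
  have hsub : superlevel c X a b y k' ∪ (X ∩ (fun x => costDy c a b x y) ⁻¹' Ioo k k') ⊆
      superlevel c X a b y k := by
    rintro x (hx | hx)
    · exact ⟨hx.1, hk.le.trans hx.2⟩
    · exact ⟨hx.1, hx.2.1.le⟩
  calc μ.real (superlevel c X a b y k')
      < μ.real (superlevel c X a b y k') + μ.real (X ∩ (fun x => costDy c a b x y) ⁻¹' Ioo k k') :=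
        lt_add_of_pos_right _ (ENNReal.toReal_pos hpos.ne' (measure_ne_top _ _))
    _ = _ := (measureReal_union hdisj hopen.measurableSet).symm
    _ ≤ _ := measureReal_mono hsub

/-- Indicators of superlevel sets converge off the limiting level set, which is null. -/
theorem IsSide.continuous_real_superlevel (h : IsSide X a b c μ) (hab : a < b) {y : ℝ}
    (hy : y ∈ Icc a b) : Continuous fun k => μ.real (superlevel c X a b y k) := by
  have := h.isProbabilityMeasure
  refine continuous_iff_continuousAt.2 fun k => ?_
  refine (ENNReal.tendsto_toReal (measure_ne_top μ _)).comp ?_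
  refine tendsto_measure_of_ae_tendsto_indicator_of_isFiniteMeasure _
    (h.measurableSet_superlevel hab hy k) (fun k => h.measurableSet_superlevel hab hy k) ?_
  have hnull : ∀ᵐ x ∂μ, ¬ (x ∈ X ∧ costDy c a b x y = k) :=
    measure_eq_zero_iff_ae_notMem.1 (h.measure_level_eq_zero hy k)
  filter_upwards [hnull] with x hx
  by_cases hxX : x ∈ X
  · rcases lt_or_gt_of_ne (fun he => hx ⟨hxX, he⟩) with hlt | hlt
    · filter_upwards [Ioi_mem_nhds hlt] with k' hk'
      simp [superlevel, hxX, hlt.not_ge, (mem_Ioi.1 hk').not_ge]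
    · filter_upwards [Iio_mem_nhds hlt] with k' hk'
      simp [superlevel, hxX, hlt.le, (mem_Iio.1 hk').le]
  · simp [superlevel, hxX]

/-- At the maximum of `D_y c(·, y)` the superlevel set is a null level set, at the minimum it is
`X`; the range between them is an interval. -/
theorem IsSide.exists_level (h : IsSide X a b c μ) (hab : a < b) {y : ℝ} (hy : y ∈ Icc a b)
    {M : ℝ} (hM : M ∈ Icc (0 : ℝ) 1) :
    ∃ k ∈ (fun x => costDy c a b x y) '' closure X, μ.real (superlevel c X a b y k) = M := by
  have := h.isProbabilityMeasure
  have hf := h.continuousOn_costDy_left hab hy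
  obtain ⟨z, hz, hzmin⟩ := h.isCompact_closure.exists_isMinOn h.isConnected.nonempty.closure hf
  obtain ⟨z', hz', hzmax⟩ := h.isCompact_closure.exists_isMaxOn h.isConnected.nonempty.closure hf
  have hpre : IsPreconnected ((fun x => costDy c a b x y) '' closure X) :=
    h.isConnected.isPreconnected.closure.image _ hf
  have h0 : μ.real (superlevel c X a b y (costDy c a b z' y)) = 0 := by
    have : superlevel c X a b y (costDy c a b z' y) =
        {x | x ∈ X ∧ costDy c a b x y = costDy c a b z' y} := by
      ext x
      exact and_congr_right fun hx => ⟨fun h1 => (hzmax (subset_closure hx)).antisymm h1,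
        fun h1 => h1.ge⟩
    rw [this, Measure.real, h.measure_level_eq_zero hy, ENNReal.toReal_zero]
  have h1 : μ.real (superlevel c X a b y (costDy c a b z y)) = 1 := by
    have : superlevel c X a b y (costDy c a b z y) = X :=
      (superlevel_subset _ _).antisymm fun x hx => ⟨hx, hzmin (subset_closure hx)⟩
    rw [this, Measure.real, h.measure_eq_one, ENNReal.toReal_one]
  refine hpre.intermediate_value (mem_image_of_mem _ hz') (mem_image_of_mem _ hz)
    (h.continuous_real_superlevel hab hy).continuousOn ?_
  simp only [h0, h1]
  exact hM

theorem IsSide.splitLevel_mem (h : IsSide X a b c μ) (hab : a < b) {y : ℝ} (hy : y ∈ Icc a b)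
    {M : ℝ} (hM : M ∈ Icc (0 : ℝ) 1) :
    splitLevel c X a b μ y M ∈ (fun x => costDy c a b x y) '' closure X :=
  Function.invFunOn_mem (h.exists_level hab hy hM)

theorem IsSide.real_superlevel_splitLevel (h : IsSide X a b c μ) (hab : a < b) {y : ℝ}
    (hy : y ∈ Icc a b) {M : ℝ} (hM : M ∈ Icc (0 : ℝ) 1) :
    μ.real (superlevel c X a b y (splitLevel c X a b μ y M)) = M :=
  Function.invFunOn_eq (f := fun k : ℝ => μ.real (superlevel c X a b y k))
    (h.exists_level hab hy hM)

theorem superlevel_anti {y k k' : ℝ} (hk : k ≤ k') :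
    superlevel c X a b y k' ⊆ superlevel c X a b y k := fun _ hx => ⟨hx.1, hk.trans hx.2⟩

theorem IsSide.splitLevel_strictAntiOn (h : IsSide X a b c μ) (hab : a < b) {y : ℝ}
    (hy : y ∈ Icc a b) : StrictAntiOn (splitLevel c X a b μ y) (Icc 0 1) := by
  have := h.isProbabilityMeasure
  intro M hM M' hM' hlt
  by_contra! hcon
  have := measureReal_mono (μ := μ) (superlevel_anti (X := X) (c := c) (a := a) (b := b) (y := y)
    hcon)
  rw [h.real_superlevel_splitLevel hab hy hM, h.real_superlevel_splitLevel hab hy hM'] at this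
  linarith

/-- The superlevel set at level `k(y, 0)` is empty. -/
theorem IsSide.superlevel_splitLevel_zero (h : IsSide X a b c μ) (hab : a < b) {y : ℝ}
    (hy : y ∈ Icc a b) : superlevel c X a b y (splitLevel c X a b μ y 0) = ∅ := by
  have := h.isProbabilityMeasure
  by_contra hne
  obtain ⟨x, hx, hxk⟩ := nonempty_iff_ne_empty.2 hne
  obtain ⟨x', ⟨-, hx'⟩, hlt⟩ := h.exists_costDy_gt hx hy univ_mem
  obtain ⟨z, hz, hzk⟩ := h.splitLevel_mem hab hy (M := 0) (by simp)
  have := h.real_superlevel_lt hab hy (hxk.trans_lt hlt) hz (subset_closure hx') hzk.le le_rfl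
  rw [h.real_superlevel_splitLevel hab hy (by simp)] at this
  exact absurd measureReal_nonneg this.not_ge

/-- The strict superlevel set at level `k(y, 1)` is the whole domain. -/
theorem IsSide.strictSuperlevel_splitLevel_one (h : IsSide X a b c μ) (hab : a < b) {y : ℝ}
    (hy : y ∈ Icc a b) : strictSuperlevel c X a b y (splitLevel c X a b μ y 1) = X := by
  have := h.isProbabilityMeasure
  refine Subset.antisymm (fun x hx => hx.1) fun x hx => ⟨hx, ?_⟩
  by_contra! hxk
  obtain ⟨x', ⟨-, hx'⟩, hlt⟩ := h.exists_costDy_lt hx hy univ_mem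
  obtain ⟨z, hz, hzk⟩ := h.splitLevel_mem hab hy (M := 1) (by simp)
  have := h.real_superlevel_lt hab hy (hlt.trans_le hxk) (subset_closure hx') hz le_rfl hzk.ge
  rw [h.real_superlevel_splitLevel hab hy (by simp)] at this
  exact absurd measureReal_le_one this.not_ge

theorem IsSide.superlevel_splitLevel_one (h : IsSide X a b c μ) (hab : a < b) {y : ℝ}
    (hy : y ∈ Icc a b) : superlevel c X a b y (splitLevel c X a b μ y 1) = X :=
  (superlevel_subset _ _).antisymm
    ((h.strictSuperlevel_splitLevel_one hab hy).symm.subset.trans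
      (strictSuperlevel_subset_superlevel _ _))

/-- If the level at a nearby point were too low or too high, uniform closeness of `D_y c` would
include one superlevel set in another of strictly smaller mass. If no value at `y` lies beyond the
comparison level `s'`, the bound follows instead from the level belonging to the range of `D_y c`.
-/
theorem IsSide.continuousOn_splitLevel (h : IsSide X a b c μ) (hab : a < b) :
    ContinuousOn (Function.uncurry (splitLevel c X a b μ)) (Icc a b ×ˢ Icc 0 1) := by
  have := h.isProbabilityMeasure
  rintro ⟨y, M⟩ ⟨hy, hM⟩
  have hsnd : Tendsto Prod.snd (𝓝[Icc a b ×ˢ Icc (0 : ℝ) 1] (y, M)) (𝓝 M) :=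
    continuous_snd.continuousWithinAt
  have hfst : Tendsto Prod.fst (𝓝[Icc a b ×ˢ Icc (0 : ℝ) 1] (y, M)) (𝓝[Icc a b] y) :=
    continuous_fst.continuousWithinAt.tendsto_nhdsWithin fun p hp => hp.1
  obtain ⟨z, hz, hzk⟩ := h.splitLevel_mem hab hy hM
  have hmass := h.real_superlevel_splitLevel hab hy hM
  refine tendsto_order.2 ⟨fun s hs => ?_, fun s hs => ?_⟩
  · change s < splitLevel c X a b μ y M at hs
    obtain ⟨s', hs', hs''⟩ := exists_between hs
    by_cases hex : ∃ w ∈ closure X, costDy c a b w y ≤ s'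
    · obtain ⟨w, hw, hws⟩ := hex
      have hlt := h.real_superlevel_lt hab hy hs'' hw hz hws hzk.ge
      rw [hmass] at hlt
      filter_upwards [hfst.eventually (h.eventually_abs_costDy_sub_lt hab hy (sub_pos.2 hs')),
        hsnd.eventually (gt_mem_nhds hlt), self_mem_nhdsWithin] with q hq1 hq2 hq3
      by_contra! hcon
      have hsub : superlevel c X a b y s' ⊆
          superlevel c X a b q.1 (splitLevel c X a b μ q.1 q.2) := fun x hx =>
        ⟨hx.1, by
          have h1 := (abs_lt.1 (hq1 x (subset_closure hx.1))).1
          have h2 := hx.2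
          have h3 : splitLevel c X a b μ q.1 q.2 ≤ s := hcon
          linarith⟩
      have := measureReal_mono (μ := μ) hsub
      rw [h.real_superlevel_splitLevel hab hq3.1 hq3.2] at this
      exact (this.trans_lt hq2).false
    · push Not at hex
      filter_upwards [hfst.eventually (h.eventually_abs_costDy_sub_lt hab hy (sub_pos.2 hs')),
        self_mem_nhdsWithin] with q hq1 hq3
      obtain ⟨w, hw, hwk⟩ := h.splitLevel_mem hab hq3.1 hq3.2
      have h1 := (abs_lt.1 (hq1 w hw)).1
      have h2 := hex w hw
      change s < splitLevel c X a b μ q.1 q.2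
      rw [← hwk]
      simp only
      linarith
  · change splitLevel c X a b μ y M < s at hs
    obtain ⟨s', hs', hs''⟩ := exists_between hs
    by_cases hex : ∃ w ∈ closure X, s' ≤ costDy c a b w y
    · obtain ⟨w, hw, hws⟩ := hex
      have hlt := h.real_superlevel_lt hab hy hs' hz hw hzk.le hws
      rw [hmass] at hlt
      filter_upwards [hfst.eventually (h.eventually_abs_costDy_sub_lt hab hy (sub_pos.2 hs'')),
        hsnd.eventually (lt_mem_nhds hlt), self_mem_nhdsWithin] with q hq1 hq2 hq3
      by_contra! hcon
      have hsub : superlevel c X a b q.1 (splitLevel c X a b μ q.1 q.2) ⊆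
          superlevel c X a b y s' := fun x hx =>
        ⟨hx.1, by
          have h1 := (abs_lt.1 (hq1 x (subset_closure hx.1))).2
          have h2 := hx.2
          have h3 : s ≤ splitLevel c X a b μ q.1 q.2 := hcon
          linarith⟩
      have := measureReal_mono (μ := μ) hsub
      rw [h.real_superlevel_splitLevel hab hq3.1 hq3.2] at this
      exact (this.trans_lt hq2).false
    · push Not at hex
      filter_upwards [hfst.eventually (h.eventually_abs_costDy_sub_lt hab hy (sub_pos.2 hs'')),
        self_mem_nhdsWithin] with q hq1 hq3
      obtain ⟨w, hw, hwk⟩ := h.splitLevel_mem hab hq3.1 hq3.2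
      have h1 := (abs_lt.1 (hq1 w hw)).2
      have h2 := hex w hw
      change splitLevel c X a b μ q.1 q.2 < s
      rw [← hwk]
      simp only
      linarith

end Side

end Hedonic

namespace Hedonic

/-! ### Sign conditions and continuity of the zero `M(y)` -/

section Zero

variable {k₁ k₂ : ℝ → ℝ → ℝ} {y : ℝ}

theorem hedonicZero_mem : hedonicZero k₁ k₂ y ∈ Icc (0 : ℝ) 1 := by
  unfold hedonicZero
  split_ifs with h1 h2
  · exact Function.invFunOn_mem h1
  · simp
  · simp

/-- This and `hedonicZero_nonpos` are the complementary slackness conditions for `M ∈ [0, 1]`; they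
treat the true zero and the two boundary cases uniformly. -/
theorem hedonicZero_nonneg (h : 0 < hedonicZero k₁ k₂ y) :
    0 ≤ k₁ y (hedonicZero k₁ k₂ y) + k₂ y (hedonicZero k₁ k₂ y) := by
  unfold hedonicZero at h ⊢
  split_ifs at h ⊢ with h1 h2
  · exact (Function.invFunOn_eq (f := fun M => k₁ y M + k₂ y M) h1).ge
  · exact h2.le
  · exact (lt_irrefl _ h).elim

theorem hedonicZero_nonpos (hc : ContinuousOn (fun M => k₁ y M + k₂ y M) (Icc 0 1))
    (h : hedonicZero k₁ k₂ y < 1) :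
    k₁ y (hedonicZero k₁ k₂ y) + k₂ y (hedonicZero k₁ k₂ y) ≤ 0 := by
  unfold hedonicZero at h ⊢
  split_ifs at h ⊢ with h1 h2
  · exact (Function.invFunOn_eq (f := fun M => k₁ y M + k₂ y M) h1).le
  · exact (lt_irrefl _ h).elim
  · by_contra! hcon
    exact h1 (intermediate_value_Icc' zero_le_one hc ⟨not_lt.1 h2, hcon.le⟩)

/-- For `t` strictly below (above) `M(y)` the sum at `t` is positive (negative). This persists for
nearby `y'` and keeps `M(y')` on the same side of `t`. -/
theorem continuousOn_hedonicZero {a b : ℝ}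
    (hc : ContinuousOn (fun p : ℝ × ℝ => k₁ p.1 p.2 + k₂ p.1 p.2) (Icc a b ×ˢ Icc 0 1))
    (hs : ∀ y ∈ Icc a b, StrictAntiOn (fun M => k₁ y M + k₂ y M) (Icc 0 1)) :
    ContinuousOn (hedonicZero k₁ k₂) (Icc a b) := by
  have hcM : ∀ y ∈ Icc a b, ContinuousOn (fun M => k₁ y M + k₂ y M) (Icc 0 1) := fun y hy =>
    hc.comp (f := fun M => (y, M)) (by fun_prop) fun _ hM => ⟨hy, hM⟩
  have hcy : ∀ M ∈ Icc (0 : ℝ) 1, ContinuousOn (fun y => k₁ y M + k₂ y M) (Icc a b) :=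
    fun M hM => hc.comp (f := fun y => (y, M)) (by fun_prop) fun _ hy => ⟨hy, hM⟩
  intro y hy
  have hm : hedonicZero k₁ k₂ y ∈ Icc (0 : ℝ) 1 := hedonicZero_mem
  refine tendsto_order.2 ⟨fun s hs' => ?_, fun s hs' => ?_⟩
  · rcases lt_or_ge s 0 with h0 | h0
    · exact Eventually.of_forall fun y' => h0.trans_le hedonicZero_mem.1
    obtain ⟨t, hst, htm⟩ := exists_between hs'
    have ht : t ∈ Icc (0 : ℝ) 1 := ⟨h0.trans hst.le, htm.le.trans hm.2⟩
    have hpos : 0 < k₁ y t + k₂ y t :=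
      (hedonicZero_nonneg (ht.1.trans_lt htm)).trans_lt (hs y hy ht hm htm)
    filter_upwards [(hcy t ht y hy).eventually (lt_mem_nhds hpos), self_mem_nhdsWithin]
      with y' hy' hy'm
    by_contra! hcon
    have h1 : hedonicZero k₁ k₂ y' < t := hcon.trans_lt hst
    have h2 := hedonicZero_nonpos (hcM y' hy'm) (h1.trans_le ht.2)
    have h3 := hs y' hy'm hedonicZero_mem ht h1
    simp only at h3
    linarith
  · rcases lt_or_ge 1 s with h0 | h0
    · exact Eventually.of_forall fun y' => hedonicZero_mem.2.trans_lt h0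
    obtain ⟨t, htm, hst⟩ := exists_between hs'
    have ht : t ∈ Icc (0 : ℝ) 1 := ⟨hm.1.trans htm.le, hst.le.trans h0⟩
    have hneg : k₁ y t + k₂ y t < 0 :=
      (hs y hy hm ht htm).trans_le (hedonicZero_nonpos (hcM y hy) (htm.trans_le ht.2))
    filter_upwards [(hcy t ht y hy).eventually (gt_mem_nhds hneg), self_mem_nhdsWithin]
      with y' hy' hy'm
    by_contra! hcon
    have h1 : t < hedonicZero k₁ k₂ y' := hst.trans_le hcon
    have h2 := hedonicZero_nonneg (ht.1.trans_lt h1)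
    have h3 := hs y' hy'm ht hedonicZero_mem h1
    simp only at h3
    linarith

end Zero

/-! ### Assignment maps and distribution functions -/

/-- An increasing family of sets `A y`, `y ∈ [a, b]`, with right-continuous mass `F`, is up to null
sets the family of sublevel sets of a map to `[a, b]`. -/
theorem exists_map_of_monotoneOn {E : Type*} [MeasurableSpace E] (μ : Measure E)
    [IsProbabilityMeasure μ] {a b : ℝ} (hab : a < b) (A : ℝ → Set E) (F : ℝ → ℝ)
    (hA : ∀ y ∈ Icc a b, MeasurableSet (A y)) (hmono : MonotoneOn A (Icc a b))
    (hF : ∀ y ∈ Icc a b, μ.real (A y) = F y) (hFb : F b = 1)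
    (hcont : ∀ y ∈ Ico a b, ContinuousWithinAt F (Ioi y) y) :
    ∃ Y : E → ℝ, Measurable Y ∧ (∀ x, Y x ∈ Icc a b) ∧
      (∀ x, ∀ y ∈ Icc a b, x ∈ A y → Y x ≤ y) ∧ (∀ x, ∀ y ∈ Icc a b, Y x < y → x ∈ A y) ∧
      ∀ y ∈ Icc a b, (μ.map Y).real (Iic y) = F y := by
  -- Inserting `b` keeps the infimum in `[a, b]` even when `x` lies in no `A y`; such points are
  -- sent to `b`.
  let S : E → Set ℝ := fun x => insert b {y | y ∈ Icc a b ∧ x ∈ A y}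
  have hSne : ∀ x, (S x).Nonempty := fun x => ⟨b, mem_insert _ _⟩
  have hSlb : ∀ x, ∀ y ∈ S x, a ≤ y := by
    rintro x y (rfl | hy)
    exacts [hab.le, hy.1.1]
  have hSbdd : ∀ x, BddBelow (S x) := fun x => ⟨a, hSlb x⟩
  have hle : ∀ x, ∀ y ∈ Icc a b, x ∈ A y → sInf (S x) ≤ y := fun x y hy hxy =>
    csInf_le (hSbdd x) (mem_insert_of_mem _ ⟨hy, hxy⟩)
  have hlt : ∀ x, ∀ y ∈ Icc a b, sInf (S x) < y → x ∈ A y := by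
    intro x y hy hxy
    obtain ⟨y', hy', hlt⟩ := exists_lt_of_csInf_lt (hSne x) hxy
    rcases hy' with rfl | hy'
    · exact (hlt.not_ge hy.2).elim
    · exact hmono hy'.1 hy hlt.le hy'.2
  have hmem : ∀ x, sInf (S x) ∈ Icc a b := fun x =>
    ⟨le_csInf (hSne x) (hSlb x), csInf_le (hSbdd x) (mem_insert _ _)⟩
  have hmeas : Measurable fun x => sInf (S x) := by
    refine measurable_of_Iio fun y => ?_
    rcases le_or_gt y a with hya | hya
    · convert MeasurableSet.empty
      ext x
      simpa using hya.trans (hmem x).1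
    rcases lt_or_ge b y with hyb | hyb
    · convert MeasurableSet.univ
      ext x
      simpa using (hmem x).2.trans_lt hyb
    have : (fun x => sInf (S x)) ⁻¹' Iio y =
        ⋃ q : ℚ, ⋃ _ : (q : ℝ) < y, A (max a q) := by
      ext x
      simp only [mem_preimage, mem_Iio, mem_iUnion, exists_prop]
      constructor
      · intro hx
        obtain ⟨q, hq1, hq2⟩ := exists_rat_btwn hx
        exact ⟨q, hq2, hlt x _ ⟨le_max_left _ _, max_le hab.le (hq2.le.trans hyb)⟩
          (hq1.trans_le (le_max_right _ _))⟩
      · rintro ⟨q, hq, hx⟩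
        exact (hle x _ ⟨le_max_left _ _, max_le hab.le (hq.le.trans hyb)⟩ hx).trans_lt
          (max_lt hya hq)
    rw [this]
    exact MeasurableSet.iUnion fun q => MeasurableSet.iUnion fun hq =>
      hA _ ⟨le_max_left _ _, max_le hab.le (hq.le.trans hyb)⟩
  refine ⟨fun x => sInf (S x), hmeas, hmem, hle, hlt, fun y hy => ?_⟩
  rw [map_measureReal_apply hmeas measurableSet_Iic]
  rcases hy.2.eq_or_lt with rfl | hyb
  · have : (fun x => sInf (S x)) ⁻¹' Iic y = univ := eq_univ_of_forall fun x => (hmem x).2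
    rw [this, probReal_univ, hFb]
  · refine le_antisymm ?_ ?_
    -- The set where the infimum is at most `y` contains `A y` but may be larger; it lies in `A z`
    -- for all `z > y`, so right continuity closes the gap.
    · refine ge_of_tendsto (hcont y ⟨hy.1, hyb⟩) ?_
      filter_upwards [Ioo_mem_nhdsGT hyb] with z hz
      have hzI : z ∈ Icc a b := ⟨hy.1.trans hz.1.le, hz.2.le⟩
      rw [← hF z hzI]
      exact measureReal_mono fun x hx => hlt x z hzI (lt_of_le_of_lt hx hz.1)
    · rw [← hF y hy]
      exact measureReal_mono fun x hx => hle x y hy hx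

theorem real_Iic_eq_zero {a b : ℝ} {ν : Measure ℝ} (hν : ν ∈ probOn a b) {y : ℝ} (hy : y < a) :
    ν.real (Iic y) = 0 := by
  rw [Measure.real, measure_mono_null (fun z hz hz' => ?_) hν.2, ENNReal.toReal_zero]
  exact (hy.trans_le hz'.1).not_ge hz

theorem real_Iic_eq_one {a b : ℝ} {ν : Measure ℝ} (hν : ν ∈ probOn a b) {y : ℝ} (hy : b ≤ y) :
    ν.real (Iic y) = 1 := by
  have := hν.1
  have h1 : ν (Iic y)ᶜ = 0 :=
    measure_mono_null (compl_subset_compl.2 fun z hz => hz.2.trans hy) hν.2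
  rw [Measure.real, (prob_compl_eq_zero_iff measurableSet_Iic).1 h1, ENNReal.toReal_one]

/-- Measures on `[a, b]` are determined by their distribution functions on `[a, b]`. -/
theorem probOn_ext {a b : ℝ} {ν ν' : Measure ℝ} (hν : ν ∈ probOn a b) (hν' : ν' ∈ probOn a b)
    (h : ∀ y ∈ Icc a b, ν.real (Iic y) = ν'.real (Iic y)) : ν = ν' := by
  have := hν.1
  have := hν'.1
  refine Measure.ext_of_Iic _ _ fun y => ?_
  rw [← measureReal_eq_measureReal_iff]
  rcases lt_or_ge y a with hy | hy
  · rw [real_Iic_eq_zero hν hy, real_Iic_eq_zero hν' hy]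
  rcases lt_or_ge b y with hyb | hyb
  · rw [real_Iic_eq_one hν hyb.le, real_Iic_eq_one hν' hyb.le]
  exact h y ⟨hy, hyb⟩

theorem map_mem_probOn {E : Type*} [MeasurableSpace E] {μ : Measure E} [IsProbabilityMeasure μ]
    {a b : ℝ} {Y : E → ℝ} (hY : Measurable Y) (hmem : ∀ x, Y x ∈ Icc a b) :
    μ.map Y ∈ probOn a b := by
  refine ⟨Measure.isProbabilityMeasure_map hY.aemeasurable, ?_⟩
  rw [Measure.map_apply hY measurableSet_Icc.compl]
  convert measure_empty (μ := μ)
  ext x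
  simpa using hmem x

theorem continuousWithinAt_real_Iic {ν : Measure ℝ} [IsProbabilityMeasure ν] (y : ℝ) :
    ContinuousWithinAt (fun z => ν.real (Iic z)) (Ioi y) y := by
  have := ((cdf ν).right_continuous y).mono Ioi_subset_Ici_self
  rwa [show (cdf ν : ℝ → ℝ) = fun z => ν.real (Iic z) from funext (cdf_eq_real ν)] at this

theorem real_Iic_eq_of_measure_Icc_eq_zero {ν : Measure ℝ} [IsProbabilityMeasure ν] {y z : ℝ}
    (hyz : y ≤ z) (h : ν (Icc y z) = 0) : ν.real (Iic y) = ν.real (Iic z) := by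
  refine le_antisymm (measureReal_mono (Iic_subset_Iic.2 hyz)) ?_
  have hsub : Iic z ⊆ Iic y ∪ Icc y z := fun t ht => (le_total t y).imp id fun h' => ⟨h', ht⟩
  calc ν.real (Iic z) ≤ ν.real (Iic y ∪ Icc y z) := measureReal_mono hsub
    _ ≤ ν.real (Iic y) + ν.real (Icc y z) := measureReal_union_le _ _
    _ = ν.real (Iic y) := by simp [Measure.real, h]

end Hedonic

namespace Hedonic

/-! ### Consequences of the inclusions between superlevel sets -/

section Nested

variable {m : ℕ} {X : Set (EuclideanSpace ℝ (Fin m))} {a b : ℝ}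
  {c : EuclideanSpace ℝ (Fin m) → ℝ → ℝ} {μ : Measure (EuclideanSpace ℝ (Fin m))}

/-- In a nested model whose target has no atoms in `(a, b)`, the superlevel sets increase also
across gaps of the target. -/
theorem IsSide.monotoneOn_superlevel (h : IsSide X a b c μ) (hab : a < b) {ν : Measure ℝ}
    (hν : ν ∈ probOn a b) (hcont : ContinuousOn (fun y => ν.real (Iic y)) (Ico a b))
    (hn : IsNested c X a b μ ν) :
    MonotoneOn (fun y => superlevel c X a b y (splitLevel c X a b μ y (ν.real (Iic y))))
      (Icc a b) := by
  have := hν.1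
  have := h.isProbabilityMeasure
  have hF : ∀ y, ν.real (Iic y) ∈ Icc (0 : ℝ) 1 := fun y => ⟨measureReal_nonneg, measureReal_le_one⟩
  intro y₀ hy₀ y₁ hy₁ hle
  rcases hle.eq_or_lt with rfl | hlt
  · exact le_rfl
  rcases (zero_le (a := ν (Icc y₀ y₁))).lt_or_eq with hpos | hzero
  · exact (hn y₀ hy₀ y₁ hy₁ hlt hpos).trans (strictSuperlevel_subset_superlevel _ _)
  have hFeq := real_Iic_eq_of_measure_Icc_eq_zero hle hzero.symm
  change superlevel c X a b y₀ _ ⊆ superlevel c X a b y₁ _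
  intro x hx
  by_contra hx₁
  -- If monotonicity fails across the gap, a small move raising `D_y c(·, y₀)` gives an open set `V`
  -- of positive mass. Whenever `ν` charges `[y, y₀]`, the set at `y` lies in both later sets, hence
  -- misses `V`: the distribution function must jump by at least `μ V` between `y` and `y₀`.
  set V := strictSuperlevel c X a b y₀ (splitLevel c X a b μ y₀ (ν.real (Iic y₀))) ∩
    (X \ superlevel c X a b y₁ (splitLevel c X a b μ y₁ (ν.real (Iic y₁)))) with hV
  have hVo : IsOpen V :=
    (h.isOpen_strictSuperlevel hab hy₀ _).inter (h.isOpen_diff_superlevel hab hy₁ _)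
  have hVne : V.Nonempty := by
    obtain ⟨x', hx', hgt⟩ := h.exists_costDy_gt hx.1 hy₀
      ((h.isOpen_diff_superlevel hab hy₁ _).mem_nhds ⟨hx.1, hx₁⟩)
    exact ⟨x', ⟨hx'.2, hx.2.trans_lt hgt⟩, hx'.1⟩
  have hVpos : 0 < μ.real V :=
    ENNReal.toReal_pos (h.charges_open V hVo (fun z hz => hz.2.1) hVne).ne' (measure_ne_top _ _)
  have hgap : ∀ y ∈ Ico a y₀, 0 < ν (Icc y y₀) →
      ν.real (Iic y) + μ.real V ≤ ν.real (Iic y₀) := by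
    intro y hy hyν
    have hyI : y ∈ Icc a b := ⟨hy.1, hy.2.le.trans hy₀.2⟩
    have hs0 := (hn y hyI y₀ hy₀ hy.2 hyν).trans (strictSuperlevel_subset_superlevel _ _)
    have hs1 := (hn y hyI y₁ hy₁ (hy.2.trans hlt)
      (hyν.trans_le (measure_mono (Icc_subset_Icc_right hle)))).trans
        (strictSuperlevel_subset_superlevel _ _)
    rw [← h.real_superlevel_splitLevel hab hyI (hF y), ← measureReal_union
      (disjoint_left.2 fun z hz hz' => hz'.2.2 (hs1 hz)) hVo.measurableSet]
    conv_rhs => rw [← h.real_superlevel_splitLevel hab hy₀ (hF y₀)]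
    exact measureReal_mono
      (union_subset hs0 fun z hz => strictSuperlevel_subset_superlevel _ _ hz.1)
  have hθ : 0 < ν.real (Iic y₀) := by
    rcases (hF y₀).1.eq_or_lt with h0 | h0
    · rw [← h0, h.superlevel_splitLevel_zero hab hy₀] at hx
      exact hx.elim
    · exact h0
  have ha : 0 < ν (Icc a y₀) := by
    rw [pos_iff_ne_zero]
    intro h0
    refine hθ.ne' ?_
    rw [Measure.real, measure_mono_null (t := (Icc a b)ᶜ ∪ Icc a y₀) ?_
      (measure_union_null hν.2 h0), ENNReal.toReal_zero]
    intro z hz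
    rcases lt_or_ge z a with hza | hza
    · exact Or.inl fun hz' => hza.not_ge hz'.1
    · exact Or.inr ⟨hza, hz⟩
  have hay : a < y₀ := by
    rcases hy₀.1.eq_or_lt with rfl | hay
    · exact absurd (measure_mono_null (Icc_subset_Icc_right hle) hzero.symm) (by simpa using ha.ne')
    · exact hay
  have hstart := hgap a ⟨le_rfl, hay⟩ ha
  -- A value half a jump below that at `y₀` is attained by continuity, which contradicts `hgap`.
  obtain ⟨y, hy, hyF⟩ := intermediate_value_Icc hay.le
    (hcont.mono fun z hz => ⟨hz.1, hz.2.trans_lt (hlt.trans_le hy₁.2)⟩)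
    (show ν.real (Iic y₀) - μ.real V / 2 ∈ _ from ⟨by linarith, by linarith⟩)
  simp only at hyF
  have hyne : y < y₀ := hy.2.lt_of_ne (by rintro rfl; linarith)
  rcases (zero_le (a := ν (Icc y y₀))).lt_or_eq with hp | hz
  · linarith [hgap y ⟨hy.1, hyne⟩ hp]
  · linarith [real_Iic_eq_of_measure_Icc_eq_zero hy.2 hz.symm]

theorem IsSide.continuousOn_splitLevel_comp (h : IsSide X a b c μ) (hab : a < b) {M : ℝ → ℝ}
    (hMc : ContinuousOn M (Icc a b)) (hM : ∀ y, M y ∈ Icc (0 : ℝ) 1) :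
    ContinuousOn (fun y => splitLevel c X a b μ y (M y)) (Icc a b) :=
  (h.continuousOn_splitLevel hab).comp (f := fun y => (y, M y)) (continuousOn_id.prodMk hMc)
    fun y hy => ⟨hy, hM y⟩

/-- Extends the inclusion to the left endpoint `a`: a point of the set at `a` outside the set at an
intermediate `y'` can be moved so that its inequality at `a` is strict; by continuity it then lies
in the sets at `y` slightly above `a`, hence in the one at `y'`. -/
theorem IsSide.subset_strictSuperlevel_of_hedonicInclusion (h : IsSide X a b c μ) (hab : a < b)
    {M : ℝ → ℝ} (hMc : ContinuousOn M (Icc a b)) (hM : ∀ y, M y ∈ Icc (0 : ℝ) 1)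
    (hn : HedonicInclusion c X a b μ M) {y₀ y₁ : ℝ} (hy₀ : a ≤ y₀) (hlt : y₀ < y₁) (hy₁ : y₁ < b) :
    superlevel c X a b y₀ (splitLevel c X a b μ y₀ (M y₀)) ⊆
      strictSuperlevel c X a b y₁ (splitLevel c X a b μ y₁ (M y₁)) := by
  rcases hy₀.eq_or_lt with rfl | hay
  swap
  · exact hn y₀ ⟨hay, hlt.trans hy₁⟩ y₁ ⟨hay.trans hlt, hy₁⟩ hlt
  obtain ⟨y', hy', hy'₁⟩ := exists_between hlt
  have hy'I : y' ∈ Ioo a b := ⟨hy', hy'₁.trans hy₁⟩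
  have haI : a ∈ Icc a b := ⟨le_rfl, hab.le⟩
  refine Subset.trans (fun x hx => ?_) (hn y' hy'I y₁ ⟨hlt, hy₁⟩ hy'₁)
  by_contra hx'
  obtain ⟨z, ⟨hzU, hzX⟩, hgt⟩ := h.exists_costDy_gt hx.1 haI
    ((h.isOpen_diff_superlevel hab (Ioo_subset_Icc_self hy'I) _).mem_nhds ⟨hx.1, hx'⟩)
  have hev := ((h.continuousOn_splitLevel_comp hab hMc hM) a haI).eventually_lt
    ((h.continuousOn_costDy_right hab (subset_closure hzX)) a haI) (hx.2.trans_lt hgt)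
  have hev' : ∀ᶠ y in 𝓝[>] a, splitLevel c X a b μ y (M y) < costDy c a b z y :=
    hev.filter_mono (nhdsWithin_le_iff.2 (Icc_mem_nhdsGT hab))
  obtain ⟨y, hy, hyI⟩ := (hev'.and (Ioo_mem_nhdsGT hy')).exists
  exact hzU.2 (strictSuperlevel_subset_superlevel _ _
    (hn y ⟨hyI.1, hyI.2.trans hy'I.2⟩ y' hy'I hyI.2 ⟨hzX, hy.le⟩))

/-- The strict superlevel set at `z` and the complement of the superlevel set at `y` are open,
nonempty and cover the connected set `X`. They overlap, and the overlap carries the extra mass. -/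
theorem IsSide.lt_of_subset_strictSuperlevel (h : IsSide X a b c μ) (hab : a < b) {y z M N : ℝ}
    (hy : y ∈ Icc a b) (hz : z ∈ Icc a b) (hM : M ∈ Ioo (0 : ℝ) 1) (hN : N ∈ Ioo (0 : ℝ) 1)
    (hs : superlevel c X a b y (splitLevel c X a b μ y M) ⊆
      strictSuperlevel c X a b z (splitLevel c X a b μ z N)) : M < N := by
  have := h.isProbabilityMeasure
  have hmM := h.real_superlevel_splitLevel hab hy (Ioo_subset_Icc_self hM)
  have hmN := h.real_superlevel_splitLevel hab hz (Ioo_subset_Icc_self hN)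
  have hu := h.isOpen_strictSuperlevel hab hz (splitLevel c X a b μ z N)
  have hv := h.isOpen_diff_superlevel hab hy (splitLevel c X a b μ y M)
  have hne : (X ∩ (strictSuperlevel c X a b z (splitLevel c X a b μ z N) ∩
      (X \ superlevel c X a b y (splitLevel c X a b μ y M)))).Nonempty := by
    refine h.isConnected.isPreconnected _ _ hu hv (fun x hx => ?_) ?_ ?_
    · by_cases hxy : x ∈ superlevel c X a b y (splitLevel c X a b μ y M)
      · exact Or.inl (hs hxy)
      · exact Or.inr ⟨hx, hxy⟩
    · have : (superlevel c X a b y (splitLevel c X a b μ y M)).Nonempty := by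
        refine nonempty_iff_ne_empty.2 fun h0 => hM.1.ne ?_
        rw [← hmM, h0, measureReal_empty]
      exact this.mono fun x hx => ⟨hx.1, hs hx⟩
    · by_contra hcon
      have hX : superlevel c X a b y (splitLevel c X a b μ y M) = X :=
        (superlevel_subset _ _).antisymm fun x hx => by
          by_contra hx'
          exact hcon ⟨x, hx, hx, hx'⟩
      rw [hX, Measure.real, h.measure_eq_one, ENNReal.toReal_one] at hmM
      exact hM.2.ne' hmM
  have hpos := h.charges_open _ (hu.inter hv) (fun x hx => hx.1.1) (hne.mono inter_subset_right)
  have hpos' := ENNReal.toReal_pos hpos.ne' (measure_ne_top μ _)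
  have hle := measureReal_mono (μ := μ) ((union_subset hs
    (inter_subset_left (t := X \ superlevel c X a b y (splitLevel c X a b μ y M)))).trans
      (strictSuperlevel_subset_superlevel _ _))
  rw [measureReal_union (disjoint_left.2 fun x hx hx' => hx'.2.2 hx) (hu.inter hv).measurableSet,
    hmM, hmN] at hle
  have : 0 < μ.real (strictSuperlevel c X a b z (splitLevel c X a b μ z N) ∩
      (X \ superlevel c X a b y (splitLevel c X a b μ y M))) := hpos'
  linarith

end Nested

/-! ### Kantorovich duality for a nested model -/

section Potential

/-- The dual potential on `[a, b]`, with derivative `k(y, M(y))`. -/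
noncomputable def potential {E : Type*} [TopologicalSpace E] [MeasurableSpace E] (c : E → ℝ → ℝ) (X : Set E)
    (a b : ℝ) (μ : Measure E) (M : ℝ → ℝ) (y : ℝ) : ℝ :=
  ∫ s in a..y, splitLevel c X a b μ s (M s)

theorem integrable_of_continuousOn {E : Type*} [TopologicalSpace E]
    [TopologicalSpace.PseudoMetrizableSpace E] [SecondCountableTopology E] [T2Space E]
    [MeasurableSpace E]
    [BorelSpace E] {ρ : Measure E} [IsFiniteMeasure ρ] {K : Set E} (hK : IsCompact K)
    {g : E → ℝ} (hg : ContinuousOn g K) (hρ : ρ Kᶜ = 0) : Integrable g ρ := by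
  have := hg.integrableOn_compact (μ := ρ) hK
  rwa [IntegrableOn, Measure.restrict_eq_self_of_ae_mem (measure_eq_zero_iff_ae_notMem.1 hρ |>.mono
    fun x hx => not_not.1 hx)] at this

/-- A continuous function on `[a, b]` whose derivative changes sign from `≤ 0` to `≥ 0` at `t`
attains its minimum at `t`. -/
theorem le_of_deriv_sign_change {a b t : ℝ} (ht : t ∈ Icc a b) {g g' : ℝ → ℝ}
    (hg : ContinuousOn g (Icc a b)) (hd : ∀ y ∈ Ioo a b, HasDerivAt g (g' y) y)
    (hneg : ∀ y ∈ Ioo a t, g' y ≤ 0) (hpos : ∀ y ∈ Ioo t b, 0 ≤ g' y) {y : ℝ}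
    (hy : y ∈ Icc a b) : g t ≤ g y := by
  rcases le_total y t with hyt | hyt
  · refine antitoneOn_of_deriv_nonpos (convex_Icc a t) (hg.mono (Icc_subset_Icc_right ht.2))
      ?_ ?_ ⟨hy.1, hyt⟩ ⟨ht.1, le_rfl⟩ hyt
    · rw [interior_Icc]
      exact fun z hz => (hd z ⟨hz.1, hz.2.trans_le ht.2⟩).differentiableAt.differentiableWithinAt
    · rw [interior_Icc]
      intro z hz
      rw [(hd z ⟨hz.1, hz.2.trans_le ht.2⟩).deriv]
      exact hneg z hz
  · refine monotoneOn_of_deriv_nonneg (convex_Icc t b) (hg.mono (Icc_subset_Icc_left ht.1))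
      ?_ ?_ ⟨le_rfl, ht.2⟩ ⟨hyt, hy.2⟩ hyt
    · rw [interior_Icc]
      exact fun z hz => (hd z ⟨ht.1.trans_lt hz.1, hz.2⟩).differentiableAt.differentiableWithinAt
    · rw [interior_Icc]
      intro z hz
      rw [(hd z ⟨ht.1.trans_lt hz.1, hz.2⟩).deriv]
      exact hpos z hz

variable {m : ℕ} {X : Set (EuclideanSpace ℝ (Fin m))} {a b : ℝ}
  {c : EuclideanSpace ℝ (Fin m) → ℝ → ℝ} {μ : Measure (EuclideanSpace ℝ (Fin m))}

theorem IsSide.continuousOn_potential (h : IsSide X a b c μ) (hab : a < b) {M : ℝ → ℝ}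
    (hMc : ContinuousOn M (Icc a b)) (hM : ∀ y, M y ∈ Icc (0 : ℝ) 1) :
    ContinuousOn (potential c X a b μ M) (Icc a b) := by
  have := h.continuousOn_splitLevel_comp hab hMc hM
  rw [← uIcc_of_le hab.le] at this ⊢
  exact intervalIntegral.continuousOn_primitive_interval (this.integrableOn_compact isCompact_uIcc)

theorem IsSide.hasDerivAt_potential (h : IsSide X a b c μ) (hab : a < b) {M : ℝ → ℝ}
    (hMc : ContinuousOn M (Icc a b)) (hM : ∀ y, M y ∈ Icc (0 : ℝ) 1) {y : ℝ} (hy : y ∈ Ioo a b) :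
    HasDerivAt (potential c X a b μ M) (splitLevel c X a b μ y (M y)) y := by
  have hφ := h.continuousOn_splitLevel_comp hab hMc hM
  refine intervalIntegral.integral_hasDerivAt_right ?_ ?_ (hφ.continuousAt (Icc_mem_nhds hy.1 hy.2))
  · refine ContinuousOn.intervalIntegrable (hφ.mono ?_)
    rw [uIcc_of_le hy.1.le]
    exact Icc_subset_Icc_right hy.2.le
  · exact ContinuousOn.stronglyMeasurableAtFilter isOpen_Ioo (hφ.mono Ioo_subset_Icc_self) y hy

theorem IsSide.couplings_compl_eq_zero (h : IsSide X a b c μ) {ν : Measure ℝ}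
    (hν : ν ∈ probOn a b) {γ : Measure (EuclideanSpace ℝ (Fin m) × ℝ)}
    (hγ : γ ∈ couplings μ ν) : γ (X ×ˢ Icc a b)ᶜ = 0 := by
  rw [compl_prod_eq_union]
  refine measure_union_null ?_ ?_
  · have := h.concentrated
    rw [← hγ.1, Measure.map_apply measurable_fst h.isOpen.measurableSet.compl] at this
    exact measure_mono_null (fun p hp => hp.1) this
  · have := hν.2
    rw [← hγ.2, Measure.map_apply measurable_snd measurableSet_Icc.compl] at this
    exact measure_mono_null (fun p hp => hp.2) this

theorem IsSide.isProbabilityMeasure_of_mem_couplings (h : IsSide X a b c μ) {ν : Measure ℝ}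
    {γ : Measure (EuclideanSpace ℝ (Fin m) × ℝ)} (hγ : γ ∈ couplings μ ν) :
    IsProbabilityMeasure γ := by
  have := h.isProbabilityMeasure
  rw [← hγ.1] at this
  exact (Measure.isProbabilityMeasure_map_iff measurable_fst.aemeasurable).1 this

theorem IsSide.integrable_cost (h : IsSide X a b c μ) {ν : Measure ℝ}
    (hν : ν ∈ probOn a b) {γ : Measure (EuclideanSpace ℝ (Fin m) × ℝ)}
    (hγ : γ ∈ couplings μ ν) : Integrable (fun p => c p.1 p.2) γ := by
  have := h.isProbabilityMeasure_of_mem_couplings hγ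
  exact integrable_of_continuousOn (h.isCompact_closure.prod isCompact_Icc)
    (g := Function.uncurry c) h.contDiffOn.continuousOn
    (measure_mono_null (compl_subset_compl.2 (prod_mono_left subset_closure))
      (h.couplings_compl_eq_zero hν hγ))

/-- The potential solves the dual problem of a nested model. -/
theorem IsSide.exists_le_transportCost (h : IsSide X a b c μ) (hab : a < b) {ν : Measure ℝ}
    (hν : ν ∈ probOn a b) (hn : IsNested c X a b μ ν) {M : ℝ → ℝ}
    (hMc : ContinuousOn M (Icc a b)) (hM : ∀ y, M y ∈ Icc (0 : ℝ) 1)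
    (hMν : ∀ y ∈ Ioo a b, ν.real (Iic y) = M y) :
    ∃ U : ℝ, transportCost c μ ν ≤ U + ∫ y, potential c X a b μ M y ∂ν ∧
      ∀ ν' ∈ probOn a b, U + ∫ y, potential c X a b μ M y ∂ν' ≤ transportCost c μ ν' := by
  have := hν.1
  have := h.isProbabilityMeasure
  have hF : ∀ y, ν.real (Iic y) ∈ Icc (0 : ℝ) 1 := fun y => ⟨measureReal_nonneg, measureReal_le_one⟩
  have hcont : ContinuousOn (fun y => ν.real (Iic y)) (Ico a b) := by
    intro y hy
    rcases hy.1.eq_or_lt with rfl | hay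
    · exact (continuousWithinAt_Ioi_iff_Ici.1 (continuousWithinAt_real_Iic _)).mono
        Ico_subset_Ici_self
    · refine ContinuousAt.continuousWithinAt ?_
      refine (hMc.continuousAt (Icc_mem_nhds hay hy.2)).congr ?_
      filter_upwards [Ioo_mem_nhds hay hy.2] with z hz using (hMν z hz).symm
  obtain ⟨Y, hYm, hYI, hYle, hYlt, hYF⟩ := exists_map_of_monotoneOn μ hab
    (fun y => superlevel c X a b y (splitLevel c X a b μ y (ν.real (Iic y))))
    (fun y => ν.real (Iic y)) (fun y hy => h.measurableSet_superlevel hab hy _)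
    (h.monotoneOn_superlevel hab hν hcont hn)
    (fun y hy => h.real_superlevel_splitLevel hab hy (hF y)) (real_Iic_eq_one hν le_rfl)
    (fun y _ => continuousWithinAt_real_Iic y)
  have hmap : μ.map Y = ν := probOn_ext (map_mem_probOn hYm hYI) hν hYF
  have hvc := h.continuousOn_potential hab hMc hM
  have hvint : ∀ ν' ∈ probOn a b, Integrable (potential c X a b μ M) ν' := fun ν' hν' => by
    have := hν'.1
    exact integrable_of_continuousOn isCompact_Icc hvc hν'.2
  -- The derivative in `y` is `D_y c - k(y, M(y))`: nonpositive before `Y x`, where `x` is not yet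
  -- in the superlevel set, and nonnegative after.
  have hdual : ∀ x ∈ X, ∀ y ∈ Icc a b,
      c x (Y x) - potential c X a b μ M (Y x) ≤ c x y - potential c X a b μ M y := by
    intro x hx y hy
    have hxc := subset_closure hx
    refine le_of_deriv_sign_change (hYI x) (g := fun y => c x y - potential c X a b μ M y)
      (g' := fun y => costDy c a b x y - splitLevel c X a b μ y (M y)) ?_ ?_ ?_ ?_ hy
    · exact ContinuousOn.sub
        (fun z hz => (h.hasDerivWithinAt hab hxc hz).continuousWithinAt) hvc
    · exact fun z hz => ((h.hasDerivWithinAt hab hxc (Ioo_subset_Icc_self hz)).hasDerivAt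
        (Icc_mem_nhds hz.1 hz.2)).sub (h.hasDerivAt_potential hab hMc hM hz)
    · intro z hz
      have hzI : z ∈ Ioo a b := ⟨hz.1, hz.2.trans_le (hYI x).2⟩
      by_contra! hcon
      refine hz.2.not_ge (hYle x z (Ioo_subset_Icc_self hzI) ⟨hx, ?_⟩)
      rw [hMν z hzI]
      linarith
    · intro z hz
      have hzI : z ∈ Ioo a b := ⟨(hYI x).1.trans_lt hz.1, hz.2⟩
      have := (hYlt x z (Ioo_subset_Icc_self hzI) hz.1).2
      rw [hMν z hzI] at this
      linarith
  have hpair : Measurable fun x => (x, Y x) := measurable_id.prodMk hYm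
  have hγ : μ.map (fun x => (x, Y x)) ∈ couplings μ ν := by
    refine ⟨?_, ?_⟩
    · rw [Measure.map_map measurable_fst hpair]
      exact Measure.map_id
    · rw [Measure.map_map measurable_snd hpair]
      exact hmap
  have hcint := h.integrable_cost hν hγ
  have hcint' : Integrable (fun x => c x (Y x)) μ := hcint.comp_measurable hpair
  have hvint' : Integrable (fun x => potential c X a b μ M (Y x)) μ :=
    Integrable.comp_measurable (g := potential c X a b μ M) (by rw [hmap]; exact hvint ν hν) hYm
  have huint := hcint'.sub hvint'
  have hlow : ∀ ν' ∈ probOn a b, ∀ γ ∈ couplings μ ν',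
      (∫ x, (c x (Y x) - potential c X a b μ M (Y x)) ∂μ) + ∫ y, potential c X a b μ M y ∂ν' ≤
        ∫ p, c p.1 p.2 ∂γ := by
    intro ν' hν' γ hγ'
    have hu : Integrable (fun p : EuclideanSpace ℝ (Fin m) × ℝ =>
        c p.1 (Y p.1) - potential c X a b μ M (Y p.1)) γ :=
      Integrable.comp_measurable (g := fun x => c x (Y x) - potential c X a b μ M (Y x))
        (by rw [hγ'.1]; exact huint) measurable_fst
    have hv : Integrable (fun p : EuclideanSpace ℝ (Fin m) × ℝ => potential c X a b μ M p.2) γ :=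
      Integrable.comp_measurable (g := potential c X a b μ M)
        (by rw [hγ'.2]; exact hvint ν' hν') measurable_snd
    have e1 := integral_map (μ := γ) (f := fun x => c x (Y x) - potential c X a b μ M (Y x))
      measurable_fst.aemeasurable (by rw [hγ'.1]; exact huint.aestronglyMeasurable)
    rw [hγ'.1] at e1
    have e2 : ∫ y, potential c X a b μ M y ∂ν' = ∫ p, potential c X a b μ M p.2 ∂γ := by
      conv_lhs => rw [← hγ'.2]
      exact integral_map measurable_snd.aemeasurable
        (by rw [hγ'.2]; exact (hvint ν' hν').aestronglyMeasurable)
    rw [e1, e2, ← integral_add hu hv]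
    refine integral_mono_ae (hu.add hv) (h.integrable_cost hν' hγ') ?_
    filter_upwards [measure_eq_zero_iff_ae_notMem.1 (h.couplings_compl_eq_zero hν' hγ')] with p hp
    have hp' := not_not.1 hp
    have := hdual p.1 hp'.1 p.2 hp'.2
    linarith
  refine ⟨∫ x, (c x (Y x) - potential c X a b μ M (Y x)) ∂μ, ?_, fun ν' hν' => ?_⟩
  · refine (csInf_le ⟨_, forall_mem_image.2 (hlow ν hν)⟩ (mem_image_of_mem _ hγ)).trans_eq ?_
    rw [integral_map hpair.aemeasurable hcint.aestronglyMeasurable, integral_sub hcint' hvint']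
    have : ∫ y, potential c X a b μ M y ∂ν = ∫ x, potential c X a b μ M (Y x) ∂μ := by
      conv_lhs => rw [← hmap]
      exact integral_map hYm.aemeasurable (by rw [hmap]; exact (hvint ν hν).aestronglyMeasurable)
    rw [this]
    ring
  · have := hν'.1
    -- The product coupling is needed because `sInf ∅ = 0` in `ℝ`.
    refine le_csInf (Nonempty.image _ ⟨μ.prod ν', ?_, ?_⟩) ?_
    · simp [Measure.map_fst_prod]
    · simp [Measure.map_snd_prod]
    · rintro _ ⟨γ, hγ', rfl⟩
      exact hlow ν' hν' γ hγ'

end Potential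

end Hedonic

namespace Hedonic

/-! ### Hedonic nestedness and optimality -/

section Hedonic

theorem IsSide.hedonicInclusion_of_isNested {m : ℕ} {X : Set (EuclideanSpace ℝ (Fin m))} {a b : ℝ}
    {c : EuclideanSpace ℝ (Fin m) → ℝ → ℝ} {μ : Measure (EuclideanSpace ℝ (Fin m))}
    (h : IsSide X a b c μ) (hab : a < b) {ν : Measure ℝ} (hν : ν ∈ probOn a b)
    (hn : IsNested c X a b μ ν) {M : ℝ → ℝ} (hM : ∀ y, M y ∈ Icc (0 : ℝ) 1)
    (hMν : ∀ y ∈ Ioo a b, ν.real (Iic y) = M y)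
    (hs : StrictMonoOn M {y | y ∈ Ioo a b ∧ 0 < M y ∧ M y < 1}) :
    HedonicInclusion c X a b μ M := by
  have := hν.1
  intro y hy z hz hyz
  have hyI := Ioo_subset_Icc_self hy
  have hzI := Ioo_subset_Icc_self hz
  rcases (zero_le (a := ν (Icc y z))).lt_or_eq with hpos | hzero
  · have := hn y hyI z hzI hyz hpos
    rwa [hMν y hy, hMν z hz] at this
  have heq := real_Iic_eq_of_measure_Icc_eq_zero hyz.le hzero.symm
  rw [hMν y hy, hMν z hz] at heq
  rcases (hM y).1.eq_or_lt with h0 | h0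
  · rw [← h0, h.superlevel_splitLevel_zero hab hyI]
    exact empty_subset _
  rcases (hM z).2.eq_or_lt with h1 | h1
  · rw [h1, h.strictSuperlevel_splitLevel_one hab hzI]
    exact superlevel_subset _ _
  · exact absurd heq (hs ⟨hy, h0, heq.trans_lt h1⟩ ⟨hz, h0.trans_eq heq, h1⟩ hyz).ne

theorem IsSide.isNested_of_hedonicInclusion {m : ℕ} {X : Set (EuclideanSpace ℝ (Fin m))} {a b : ℝ}
    {c : EuclideanSpace ℝ (Fin m) → ℝ → ℝ} {μ : Measure (EuclideanSpace ℝ (Fin m))}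
    (h : IsSide X a b c μ) (hab : a < b) {ν : Measure ℝ} (hν : ν ∈ probOn a b)
    {M : ℝ → ℝ} (hMc : ContinuousOn M (Icc a b)) (hM : ∀ y, M y ∈ Icc (0 : ℝ) 1)
    (hn : HedonicInclusion c X a b μ M) (hMν : ∀ y ∈ Ico a b, ν.real (Iic y) = M y) :
    IsNested c X a b μ ν := by
  intro y₀ hy₀ y₁ hy₁ hlt _
  -- At `b` the distribution function is 1 even if `M b < 1`, and the target set is all of `X`.
  rcases hy₁.2.eq_or_lt with rfl | hy₁b
  · rw [real_Iic_eq_one hν le_rfl, h.strictSuperlevel_splitLevel_one hab hy₁]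
    exact superlevel_subset _ _
  · rw [hMν y₀ ⟨hy₀.1, hlt.trans hy₁b⟩, hMν y₁ ⟨hy₁.1, hy₁b⟩]
    exact h.subset_strictSuperlevel_of_hedonicInclusion hab hMc hM hn hy₀.1 hlt hy₁b

theorem IsSide.strictMonoOn_of_hedonicInclusion {m : ℕ} {X : Set (EuclideanSpace ℝ (Fin m))}
    {a b : ℝ} {c : EuclideanSpace ℝ (Fin m) → ℝ → ℝ} {μ : Measure (EuclideanSpace ℝ (Fin m))}
    (h : IsSide X a b c μ) (hab : a < b) {M : ℝ → ℝ} (hn : HedonicInclusion c X a b μ M) :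
    StrictMonoOn M {y | y ∈ Ioo a b ∧ 0 < M y ∧ M y < 1} := fun y hy z hz hyz =>
  h.lt_of_subset_strictSuperlevel hab (Ioo_subset_Icc_self hy.1) (Ioo_subset_Icc_self hz.1) hy.2
    hz.2 (hn y hy.1 z hz.1 hyz)

/-- Under the hedonic inclusion, `M` is on `[a, b)` the distribution function of a measure. -/
theorem IsSide.exists_probOn_of_hedonicInclusion {m : ℕ} {X : Set (EuclideanSpace ℝ (Fin m))}
    {a b : ℝ} {c : EuclideanSpace ℝ (Fin m) → ℝ → ℝ} {μ : Measure (EuclideanSpace ℝ (Fin m))}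
    (h : IsSide X a b c μ) (hab : a < b) {M : ℝ → ℝ} (hMc : ContinuousOn M (Icc a b))
    (hM : ∀ y, M y ∈ Icc (0 : ℝ) 1) (hn : HedonicInclusion c X a b μ M) :
    ∃ ν ∈ probOn a b, ∀ y ∈ Ico a b, ν.real (Iic y) = M y := by
  have := h.isProbabilityMeasure
  have hmem : ∀ y, (if y < b then M y else 1) ∈ Icc (0 : ℝ) 1 := fun y => by
    split_ifs
    exacts [hM y, by simp]
  have hmono : MonotoneOn (fun y => superlevel c X a b y
      (splitLevel c X a b μ y (if y < b then M y else 1))) (Icc a b) := by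
    intro y hy z hz hyz
    rcases hyz.eq_or_lt with rfl | hlt
    · exact le_rfl
    change superlevel c X a b y _ ⊆ superlevel c X a b z _
    rcases hz.2.eq_or_lt with rfl | hzb
    · rw [if_neg (lt_irrefl z), h.superlevel_splitLevel_one hab hz]
      exact superlevel_subset _ _
    · rw [if_pos hzb, if_pos (hlt.trans hzb)]
      exact (h.subset_strictSuperlevel_of_hedonicInclusion hab hMc hM hn hy.1 hlt hzb).trans
        (strictSuperlevel_subset_superlevel _ _)
  have hcont : ∀ y ∈ Ico a b,
      ContinuousWithinAt (fun y => if y < b then M y else 1) (Ioi y) y := by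
    intro y hy
    have h1 : ContinuousWithinAt M (Ioi y) y :=
      (hMc y ⟨hy.1, hy.2.le⟩).mono_of_mem_nhdsWithin
        (mem_of_superset (Ioo_mem_nhdsGT hy.2) fun z hz => ⟨hy.1.trans hz.1.le, hz.2.le⟩)
    refine h1.congr_of_eventuallyEq ?_ (if_pos hy.2)
    filter_upwards [Ioo_mem_nhdsGT hy.2] with z hz using if_pos hz.2
  obtain ⟨Y, hYm, hYI, -, -, hY⟩ := exists_map_of_monotoneOn μ hab _ _
    (fun y hy => h.measurableSet_superlevel hab hy _) hmono
    (fun y hy => h.real_superlevel_splitLevel hab hy (hmem y)) (by simp) hcont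
  refine ⟨μ.map Y, map_mem_probOn hYm hYI, fun y hy => ?_⟩
  rw [hY y ⟨hy.1, hy.2.le⟩, if_pos hy.2]

/-- A function on `[a, b]` that is antitone while `F < 1` and monotone while `F > 0` is minimal
almost everywhere with respect to the measure with distribution function `F`. -/
theorem ae_forall_le_of_probOn {a b : ℝ} {ν : Measure ℝ} (hν : ν ∈ probOn a b) {V V' : ℝ → ℝ}
    (hV : ContinuousOn V (Icc a b)) (hd : ∀ y ∈ Ioo a b, HasDerivAt V (V' y) y)
    (hneg : ∀ y ∈ Ioo a b, ν.real (Iic y) < 1 → V' y ≤ 0)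
    (hpos : ∀ y ∈ Ioo a b, 0 < ν.real (Iic y) → 0 ≤ V' y) :
    ∀ᵐ t ∂ν, ∀ y ∈ Icc a b, V t ≤ V y := by
  have := hν.1
  have hI : ∀ᵐ t ∂ν, t ∈ Icc a b :=
    (measure_eq_zero_iff_ae_notMem.1 hν.2).mono fun t ht => not_not.1 ht
  -- If the distribution function is already 1 at `q`, the points beyond `q` are null. Restricting
  -- to rational `q` leaves a single exceptional null set.
  have h1 : ∀ᵐ t ∂ν, ∀ q : ℚ, (q : ℝ) < t → ν.real (Iic (q : ℝ)) < 1 := by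
    refine ae_all_iff.2 fun q => ?_
    rcases (measureReal_le_one (μ := ν) (s := Iic (q : ℝ))).lt_or_eq with hq | hq
    · exact Eventually.of_forall fun _ _ => hq
    · have h0 : ν (Iic (q : ℝ))ᶜ = 0 := by
        rw [prob_compl_eq_zero_iff measurableSet_Iic, ← ENNReal.toReal_eq_one_iff]
        exact hq
      filter_upwards [measure_eq_zero_iff_ae_notMem.1 h0] with t ht hqt
      exact (ht (not_le.2 hqt)).elim
  have h2 : ∀ᵐ t ∂ν, ∀ q : ℚ, t < (q : ℝ) → 0 < ν.real (Iic (q : ℝ)) := by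
    refine ae_all_iff.2 fun q => ?_
    rcases (measureReal_nonneg (μ := ν) (s := Iic (q : ℝ))).lt_or_eq with hq | hq
    · exact Eventually.of_forall fun _ _ => hq
    · have h0 : ν (Iic (q : ℝ)) = 0 := (measureReal_eq_zero_iff).1 hq.symm
      filter_upwards [measure_eq_zero_iff_ae_notMem.1 h0] with t ht hqt
      exact (ht hqt.le).elim
  filter_upwards [hI, h1, h2] with t ht h1 h2 y hy
  refine le_of_deriv_sign_change ht hV hd (fun z hz => ?_) (fun z hz => ?_) hy
  · obtain ⟨q, hzq, hqt⟩ := exists_rat_btwn hz.2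
    exact hneg z ⟨hz.1, hz.2.trans_le ht.2⟩
      ((measureReal_mono (Iic_subset_Iic.2 hzq.le)).trans_lt (h1 q hqt))
  · obtain ⟨q, htq, hqz⟩ := exists_rat_btwn hz.1
    exact hpos z ⟨ht.1.trans_lt hz.1, hz.2⟩
      ((h2 q htq).trans_le (measureReal_mono (Iic_subset_Iic.2 hqz.le)))

variable {m₁ m₂ : ℕ} {X₁ : Set (EuclideanSpace ℝ (Fin m₁))}
  {X₂ : Set (EuclideanSpace ℝ (Fin m₂))} {a b : ℝ}
  {c₁ : EuclideanSpace ℝ (Fin m₁) → ℝ → ℝ} {c₂ : EuclideanSpace ℝ (Fin m₂) → ℝ → ℝ}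
  {μ₁ : Measure (EuclideanSpace ℝ (Fin m₁))} {μ₂ : Measure (EuclideanSpace ℝ (Fin m₂))}

theorem IsSide.continuousOn_hedonicZero (h₁ : IsSide X₁ a b c₁ μ₁) (h₂ : IsSide X₂ a b c₂ μ₂)
    (hab : a < b) :
    ContinuousOn (hedonicZero (splitLevel c₁ X₁ a b μ₁) (splitLevel c₂ X₂ a b μ₂)) (Icc a b) :=
  Hedonic.continuousOn_hedonicZero
    ((h₁.continuousOn_splitLevel hab).add (h₂.continuousOn_splitLevel hab))
    fun _ hy => (h₁.splitLevel_strictAntiOn hab hy).add (h₂.splitLevel_strictAntiOn hab hy)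

/-- The duality bounds of both sides are equalities at `ν`, so only `∫ (φ₁ + φ₂)` has to be
compared; its integrand attains its minimum `ν`-almost everywhere. -/
theorem IsSide.isMinOn_of_isNested (h₁ : IsSide X₁ a b c₁ μ₁) (h₂ : IsSide X₂ a b c₂ μ₂)
    (hab : a < b) {ν : Measure ℝ} (hν : ν ∈ probOn a b)
    (hMν : ∀ y ∈ Ioo a b, ν.real (Iic y) =
      hedonicZero (splitLevel c₁ X₁ a b μ₁) (splitLevel c₂ X₂ a b μ₂) y)
    (hn₁ : IsNested c₁ X₁ a b μ₁ ν) (hn₂ : IsNested c₂ X₂ a b μ₂ ν) :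
    IsMinOn (fun ν' => transportCost c₁ μ₁ ν' + transportCost c₂ μ₂ ν') (probOn a b) ν := by
  have := hν.1
  have hMc := h₁.continuousOn_hedonicZero h₂ hab
  have hM : ∀ y, hedonicZero (splitLevel c₁ X₁ a b μ₁) (splitLevel c₂ X₂ a b μ₂) y ∈
    Icc (0 : ℝ) 1 := fun _ => hedonicZero_mem
  obtain ⟨U₁, hU₁, hU₁'⟩ := h₁.exists_le_transportCost hab hν hn₁ hMc hM hMν
  obtain ⟨U₂, hU₂, hU₂'⟩ := h₂.exists_le_transportCost hab hν hn₂ hMc hM hMν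
  set M := hedonicZero (splitLevel c₁ X₁ a b μ₁) (splitLevel c₂ X₂ a b μ₂)
  have hv₁ := h₁.continuousOn_potential hab hMc hM
  have hv₂ := h₂.continuousOn_potential hab hMc hM
  have hsum : ∀ y ∈ Icc a b, ContinuousOn
      (fun N => splitLevel c₁ X₁ a b μ₁ y N + splitLevel c₂ X₂ a b μ₂ y N) (Icc 0 1) :=
    fun y hy => ((h₁.continuousOn_splitLevel hab).add (h₂.continuousOn_splitLevel hab)).comp
      (f := fun N => (y, N)) (by fun_prop) fun _ hN => ⟨hy, hN⟩
  have hmin := ae_forall_le_of_probOn hν (hv₁.add hv₂)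
    (fun y hy => (h₁.hasDerivAt_potential hab hMc hM hy).add
      (h₂.hasDerivAt_potential hab hMc hM hy))
    (fun y hy hlt => hedonicZero_nonpos (hsum y (Ioo_subset_Icc_self hy)) ((hMν y hy).symm.trans_lt hlt))
    (fun y hy hlt => hedonicZero_nonneg (hlt.trans_eq (hMν y hy)))
  obtain ⟨t, htI, ht⟩ := isCompact_Icc.exists_isMinOn (nonempty_Icc.2 hab.le) (hv₁.add hv₂)
  intro ν' hν'
  have := hν'.1
  have hint : ∀ ρ ∈ probOn a b, Integrable (potential c₁ X₁ a b μ₁ M) ρ ∧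
      Integrable (potential c₂ X₂ a b μ₂ M) ρ := fun ρ hρ => by
    have := hρ.1
    exact ⟨integrable_of_continuousOn isCompact_Icc hv₁ hρ.2,
      integrable_of_continuousOn isCompact_Icc hv₂ hρ.2⟩
  have hle : ∫ y, (potential c₁ X₁ a b μ₁ M y + potential c₂ X₂ a b μ₂ M y) ∂ν ≤
      potential c₁ X₁ a b μ₁ M t + potential c₂ X₂ a b μ₂ M t := by
    have := integral_mono_ae ((hint ν hν).1.add (hint ν hν).2)
      (integrable_const (potential c₁ X₁ a b μ₁ M t + potential c₂ X₂ a b μ₂ M t))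
      (hmin.mono fun s hs => hs t htI)
    simpa using this
  have hge : potential c₁ X₁ a b μ₁ M t + potential c₂ X₂ a b μ₂ M t ≤
      ∫ y, (potential c₁ X₁ a b μ₁ M y + potential c₂ X₂ a b μ₂ M y) ∂ν' := by
    have := integral_mono_ae
      (integrable_const (potential c₁ X₁ a b μ₁ M t + potential c₂ X₂ a b μ₂ M t))
      ((hint ν' hν').1.add (hint ν' hν').2)
      ((measure_eq_zero_iff_ae_notMem.1 hν'.2).mono fun s hs => ht (not_not.1 hs))
    simpa using this
  rw [integral_add (hint ν hν).1 (hint ν hν).2] at hle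
  rw [integral_add (hint ν' hν').1 (hint ν' hν').2] at hge
  have e1 := hU₁' ν' hν'
  have e2 := hU₂' ν' hν'
  change transportCost c₁ μ₁ ν + transportCost c₂ μ₂ ν ≤
    transportCost c₁ μ₁ ν' + transportCost c₂ μ₂ ν'
  linarith

end Hedonic

end Hedonic

theorem mainTheorem12 {m₁ m₂ : ℕ} (hm₁ : 1 ≤ m₁) (hm₂ : 1 ≤ m₂)
    (X₁ : Set (EuclideanSpace ℝ (Fin m₁))) (X₂ : Set (EuclideanSpace ℝ (Fin m₂)))
    (a b : ℝ) (hab : a < b)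
    (c₁ : EuclideanSpace ℝ (Fin m₁) → ℝ → ℝ) (c₂ : EuclideanSpace ℝ (Fin m₂) → ℝ → ℝ)
    (μ₁ : Measure (EuclideanSpace ℝ (Fin m₁))) (μ₂ : Measure (EuclideanSpace ℝ (Fin m₂)))
    (h₁ : Hedonic.IsSide X₁ a b c₁ μ₁) (h₂ : Hedonic.IsSide X₂ a b c₂ μ₂)
    (M : ℝ → ℝ)
    (hM : M = Hedonic.hedonicZero (Hedonic.splitLevel c₁ X₁ a b μ₁)
      (Hedonic.splitLevel c₂ X₂ a b μ₂)) :
    -- hedonic nestedness is equivalent to `M` being a cumulative distribution function, without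
    -- flat pieces at levels in `(0, 1)`, of a measure for which both models are nested
    ((Hedonic.HedonicInclusion c₁ X₁ a b μ₁ M ∧ Hedonic.HedonicInclusion c₂ X₂ a b μ₂ M) ↔
      ∃ ν ∈ Hedonic.probOn a b, (∀ y ∈ Ioo a b, cdf ν y = M y) ∧
        StrictMonoOn M {y | y ∈ Ioo a b ∧ 0 < M y ∧ M y < 1} ∧
        Hedonic.IsNested c₁ X₁ a b μ₁ ν ∧ Hedonic.IsNested c₂ X₂ a b μ₂ ν) ∧
    -- and `ν` is then optimal
    (∀ ν ∈ Hedonic.probOn a b, (∀ y ∈ Ioo a b, cdf ν y = M y) →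
      Hedonic.IsNested c₁ X₁ a b μ₁ ν → Hedonic.IsNested c₂ X₂ a b μ₂ ν →
      IsMinOn (fun ν' => Hedonic.transportCost c₁ μ₁ ν' + Hedonic.transportCost c₂ μ₂ ν')
        (Hedonic.probOn a b) ν) := by
  have hMc : ContinuousOn M (Icc a b) := hM ▸ h₁.continuousOn_hedonicZero h₂ hab
  have hMI : ∀ y, M y ∈ Icc (0 : ℝ) 1 := fun y => hM ▸ Hedonic.hedonicZero_mem
  refine ⟨⟨fun hn => ?_, ?_⟩, ?_⟩
  -- The first side alone determines `ν`; the second only needs that its distribution function is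
  -- the common `M`.
  · obtain ⟨ν, hν, hMν⟩ := h₁.exists_probOn_of_hedonicInclusion hab hMc hMI hn.1
    have := hν.1
    refine ⟨ν, hν, fun y hy => ?_, h₁.strictMonoOn_of_hedonicInclusion hab hn.1,
      h₁.isNested_of_hedonicInclusion hab hν hMc hMI hn.1 hMν,
      h₂.isNested_of_hedonicInclusion hab hν hMc hMI hn.2 hMν⟩
    rw [cdf_eq_real, hMν y ⟨hy.1.le, hy.2⟩]
  · rintro ⟨ν, hν, hMν, hs, hn₁, hn₂⟩
    have := hν.1
    simp only [cdf_eq_real] at hMν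
    exact ⟨h₁.hedonicInclusion_of_isNested hab hν hn₁ hMI hMν hs,
      h₂.hedonicInclusion_of_isNested hab hν hn₂ hMI hMν hs⟩
  · intro ν hν hMν hn₁ hn₂
    have := hν.1
    simp only [cdf_eq_real, hM] at hMν
    exact h₁.isMinOn_of_isNested h₂ hab hν hMν hn₁ hn₂
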